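/- Let $k$ be a difference field ($\sigma$-field) of characteristic $0$, i.e. a field with a ring endomorphism $\sigma$, and let $\mathscr{E}_k$ be the category of $\sigma$-field extensions of $k$ (with $k$-algebra homomorphisms commuting with $\sigma$). Let $P[x]\subset\mathbb{Z}[x]$ be the semiring consisting of $0$ and the polynomials with positive leading coefficient. For $K\in\mathscr{E}_k$, $a\in K$ and $g=\sum_i c_ix^i\in\mathbb{Z}[x]$ put $a^g=\prod_i\sigma^i(a)^{c_i}$, with $0^0=1$ and $0^g=0$ for $g\in P[x]\setminus\{0\}$. *Affine $P[\sigma]$-varieties.* A $P[\sigma]$-polynomial in $y_1,\dots,y_m$ is a finite $k$-linear combination of monomials $\mathbb{Y}^{\mathbf u}=\prod_i y_i^{u_i}$, $\mathbf u\in P[x]^m$; a $P[\sigma]$-term is a constant times a monomial. An affine $P[\sigma]$-variety in $\mathbb{A}^m$ is a functor $K\mapsto \mathbb{V}_K(F)=\{a\in K^m : f(a)=0\ \forall f\in F\}$ on $\mathscr{E}_k$, where $F$ is a set of $P[\sigma]$-polynomials. A morphism $X\to Y\subseteq\mathbb{A}^n$ of such varieties is a morphism of functors of the form $a\mapsto(f_1(a),\dots,f_n(a))$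 with $P[\sigma]$-terms $f_j$. *Toric varieties.* For $U=(\mathbf u_1,\dots,\mathbf u_m)$ with $\mathbf u_i\in\mathbb{Z}[x]^n$, let $J_U$ be the set of $P[\sigma]$-polynomials $f$ with $f(\mathbb{T}^{\mathbf u_1},\dots,\mathbb{T}^{\mathbf u_m})=0$, where $\mathbb{T}=(t_1,\dots,t_n)$ are $\sigma$-indeterminates. An affine $P[\sigma]$-variety $X\subseteq\mathbb{A}^m$ is toric if $X=X_U:=\mathbb{V}(J_U)$ for some $n$ and $U$; its $\sigma$-torus is $T=X\cap(\mathbb{A}^*)^m$, a group under coordinatewise multiplication. A morphism $\phi\colon X_1\to X_2$ of affine toric $P[\sigma]$-varieties is toric if $\phi(T_1)\subseteq T_2$ and $\phi|_{T_1}\colon T_1\to T_2$ is a group homomorphism (for every $K$). *Affine $P[x]$-semimodules.* An affine $P[x]$-semimodule is a subset $S=\{\sum_{i=1}^m g_i\mathbf u_i : g_i\in P[x]\}$ of some $\mathbb{Z}[x]^n$, generated by finitely many $\mathbf u_1,\dots,\mathbf u_m\in\mathbb{Z}[x]^n$; morphisms are the maps $\phi$ with $\phi(\mathbf u+\mathbf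 v)=\phi(\mathbf u)+\phi(\mathbf v)$ and $\phi(g\mathbf u)=g\phi(\mathbf u)$ for $g\in P[x]$. Let $k[S]=\bigoplus_{\mathbf u\in S}k\chi^{\mathbf u}$ with $\chi^{\mathbf u}\chi^{\mathbf v}=\chi^{\mathbf u+\mathbf v}$ and $\sigma(\chi^{\mathbf u})=\chi^{x\mathbf u}$ (with $\sigma$ acting on coefficients as on $k$), and let $\operatorname{Spec}^{P[\sigma]}(k[S])$ be the functor sending $K\in\mathscr{E}_k$ to the set of $k$-algebra homomorphisms $k[S]\to K$ that commute with $\sigma$. **Theorem.** The category of affine toric $P[\sigma]$-varieties over $k$ with toric morphisms is antiequivalent to the category of affine $P[x]$-semimodules with $P[x]$-semimodule morphisms. More precisely, there is an antiequivalence which sends an affine $P[x]$-semimodule $S$ to an affine toric $P[\sigma]$-variety $X_S\simeq\operatorname{Spec}^{P[\sigma]}(k[S])$, the isomorphism of functors on $\mathscr{E}_k$ being natural in $S$; that is, the toric morphism $X_{S_1}\to X_{S_2}$ corresponding to $\hat\phi\colon S_2\to S_1$ is the one induced by $k[S_2]\to k[S_1]$, $\chi^{\mathbf u}\mapsto\chi^{\hat\phi(\mathbf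 u)}$. -/

import Mathlib

open CategoryTheory Opposite

universe u

namespace PDiff

/-! ### The semiring `P[x]` -/

/-- `P[x] = {f ∈ ℤ[x] | f ≥ 0}`, where `f > 0` if and only if `f` has positive leading
coefficient (the lexicographic order on coefficients, highest degree first). -/
def PX : Subsemiring (Polynomial ℤ) where
  carrier := {f | 0 ≤ f.leadingCoeff}
  mul_mem' := by
    intro a b ha hb
    simp only [Set.mem_ofPred_eq, Polynomial.leadingCoeff_mul] at *
    exact mul_nonneg ha hb
  one_mem' := by simp
  zero_mem' := by simp
  add_mem' := by
    intro a b ha hb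
    simp only [Set.mem_ofPred_eq] at *
    rcases lt_trichotomy a.degree b.degree with h | h | h
    · rwa [Polynomial.leadingCoeff_add_of_degree_lt h]
    · rcases eq_or_ne a 0 with rfl | ha0
      · simpa using hb
      rcases eq_or_ne b 0 with rfl | hb0
      · simpa using ha
      have h1 : 0 < a.leadingCoeff :=
        lt_of_le_of_ne ha (Ne.symm (Polynomial.leadingCoeff_ne_zero.2 ha0))
      rw [Polynomial.leadingCoeff_add_of_degree_eq h (by linarith)]
      exact add_nonneg ha hb
    · rwa [Polynomial.leadingCoeff_add_of_degree_lt' h]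

/-- Agreement with the definition of the order on `ℤ[x]` by comparison of coefficients. -/
theorem mem_PX_iff (f : Polynomial ℤ) :
    f ∈ PX ↔ f = 0 ∨ ∃ i, (∀ j, i < j → f.coeff j = 0) ∧ 0 < f.coeff i := by
  constructor
  · intro h
    rcases eq_or_ne f 0 with h0 | h0
    · exact Or.inl h0
    · refine Or.inr ⟨f.natDegree, fun j hj => Polynomial.coeff_eq_zero_of_natDegree_lt hj, ?_⟩
      exact lt_of_le_of_ne h (Ne.symm (Polynomial.leadingCoeff_ne_zero.2 h0))
  · rintro (rfl | ⟨i, hi, hp⟩)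
    · exact PX.zero_mem
    · have : f.natDegree = i := by
        apply le_antisymm
        · exact Polynomial.natDegree_le_iff_coeff_eq_zero.2 hi
        · exact Polynomial.le_natDegree_of_ne_zero hp.ne'
      change 0 ≤ f.coeff f.natDegree
      rw [this]
      exact hp.le

/-- The element `x` of `P[x]`. -/
noncomputable def PX.x : PX := ⟨Polynomial.X, by
  change 0 ≤ (Polynomial.X : Polynomial ℤ).leadingCoeff
  simp⟩

theorem PX.add_eq_zero {g h : PX} (hgh : g + h = 0) : g = 0 ∧ h = 0 := by
  have key : ∀ f : PX, (-(f : Polynomial ℤ)) ∈ PX → f = 0 := by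
    intro f hf
    have h1 : 0 ≤ (f : Polynomial ℤ).leadingCoeff := f.2
    have h2 : 0 ≤ (-(f : Polynomial ℤ)).leadingCoeff := hf
    rw [Polynomial.leadingCoeff_neg] at h2
    have h3 : (f : Polynomial ℤ).leadingCoeff = 0 := by linarith
    exact Subtype.ext (Polynomial.leadingCoeff_eq_zero.1 h3)
  have h' : (g : Polynomial ℤ) + h = 0 := by exact_mod_cast congrArg Subtype.val hgh
  constructor
  · apply key
    rw [neg_eq_of_add_eq_zero_right h']
    exact h.2
  · apply key
    rw [neg_eq_of_add_eq_zero_left h']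
    exact g.2

/-! ### Affine `P[x]`-semimodules -/

/-- An affine `P[x]`-semimodule: a finitely generated `P[x]`-subsemimodule of some `ℤ[x]^n`. -/
structure AffSemimod where
  /-- the rank of the ambient free module -/
  n : ℕ
  /-- the underlying subset of `ℤ[x]^n` -/
  S : Submodule PX (Fin n → Polynomial ℤ)
  fg : S.FG

/-- Morphisms are the additive maps that commute with the action of `P[x]`. -/
noncomputable instance : Category AffSemimod where
  Hom M N := M.S →ₗ[PX] N.S
  id M := LinearMap.id
  comp f g := g.comp f

/-- The `P[x]`-linear map underlying a morphism. -/
def AffSemimod.toLin {M N : AffSemimod} (φ : M ⟶ N) : M.S →ₗ[PX] N.S := φ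

/-! ### Difference fields -/

/-- `a ^ g = ∏ i, (σ^i a) ^ (c i)` for `g = ∑ i, c i * x ^ i` in `ℤ[x]` and `a` in a field with
endomorphism. In particular `0 ^ g = 0` for `g ≠ 0`, and `a ^ 0 = 1`. -/
noncomputable def spow {K : Type u} [Field K] (τ : K →+* K) (a : K) (g : Polynomial ℤ) : K :=
  ∏ i ∈ g.support, ((⇑τ)^[i] a) ^ (g.coeff i)

section spow

variable {K : Type u} [Field K] (τ : K →+* K)

theorem iterate_eq_zero (i : ℕ) (a : K) : (⇑τ)^[i] a = 0 ↔ a = 0 := by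
  rw [← RingHom.coe_pow]
  exact map_eq_zero _

@[simp] theorem spow_zero (a : K) : spow τ a 0 = 1 := by simp [spow]

theorem zero_spow {g : Polynomial ℤ} (hg : g ≠ 0) : spow τ 0 g = 0 := by
  obtain ⟨i, hi⟩ := Polynomial.support_nonempty.2 hg
  refine Finset.prod_eq_zero hi ?_
  rw [(iterate_eq_zero τ i 0).2 rfl]
  exact zero_zpow _ (Polynomial.mem_support_iff.1 hi)

theorem spow_ne_zero {a : K} (ha : a ≠ 0) (g : Polynomial ℤ) : spow τ a g ≠ 0 :=
  Finset.prod_ne_zero_iff.2 fun i _ => zpow_ne_zero _ (by rwa [Ne, iterate_eq_zero])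

@[simp] theorem one_spow (g : Polynomial ℤ) : spow τ 1 g = 1 := by
  simp [spow]

theorem mul_spow (a b : K) (g : Polynomial ℤ) : spow τ (a * b) g = spow τ a g * spow τ b g := by
  simp only [spow, ← RingHom.coe_pow, map_mul, mul_zpow, Finset.prod_mul_distrib]

theorem inv_spow (a : K) (g : Polynomial ℤ) : spow τ a⁻¹ g = (spow τ a g)⁻¹ := by
  simp only [spow, ← RingHom.coe_pow, map_inv₀, inv_zpow, Finset.prod_inv_distrib]

theorem prod_spow {ι : Type*} (s : Finset ι) (a : ι → K) (g : Polynomial ℤ) :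
    spow τ (∏ i ∈ s, a i) g = ∏ i ∈ s, spow τ (a i) g := by
  classical
  induction s using Finset.induction_on with
  | empty => simp
  | insert i s hi ih => rw [Finset.prod_insert hi, Finset.prod_insert hi, mul_spow, ih]

theorem spow_eq_prod_of_subset (a : K) (g : Polynomial ℤ) (s : Finset ℕ) (hs : g.support ⊆ s) :
    spow τ a g = ∏ i ∈ s, ((⇑τ)^[i] a) ^ (g.coeff i) := by
  refine Finset.prod_subset hs fun i _ hi => ?_
  rw [Polynomial.notMem_support_iff.1 hi, zpow_zero]

theorem spow_add_of_ne_zero {a : K} (ha : a ≠ 0) (g h : Polynomial ℤ) :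
    spow τ a (g + h) = spow τ a g * spow τ a h := by
  rw [spow_eq_prod_of_subset τ a (g + h) (g.support ∪ h.support) Polynomial.support_add,
    spow_eq_prod_of_subset τ a g (g.support ∪ h.support) Finset.subset_union_left,
    spow_eq_prod_of_subset τ a h (g.support ∪ h.support) Finset.subset_union_right,
    ← Finset.prod_mul_distrib]
  refine Finset.prod_congr rfl fun i _ => ?_
  rw [Polynomial.coeff_add, zpow_add₀ (by rwa [Ne, iterate_eq_zero])]

theorem spow_monomial (a : K) (i : ℕ) (c : ℤ) :
    spow τ a (Polynomial.monomial i c) = ((⇑τ)^[i] a) ^ c := by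
  rw [spow_eq_prod_of_subset τ a _ {i} (Polynomial.support_monomial_subset i c)]
  simp

/-- `a ^ (g * h) = (a ^ g) ^ h`. -/
theorem spow_mul (a : K) (g h : Polynomial ℤ) : spow τ a (g * h) = spow τ (spow τ a g) h := by
  rcases eq_or_ne a 0 with rfl | ha
  · rcases eq_or_ne g 0 with rfl | hg
    · simp
    rcases eq_or_ne h 0 with rfl | hh
    · simp
    rw [zero_spow τ hg, zero_spow τ hh, zero_spow τ (mul_ne_zero hg hh)]
  induction g using Polynomial.induction_on' with
  | add p q hp hq =>
    rw [add_mul, spow_add_of_ne_zero τ ha, spow_add_of_ne_zero τ ha, mul_spow, hp, hq]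
  | monomial i c =>
    induction h using Polynomial.induction_on' with
    | add p q hp hq =>
      rw [mul_add, spow_add_of_ne_zero τ ha, hp, hq,
        ← spow_add_of_ne_zero τ (spow_ne_zero τ ha _)]
    | monomial j d =>
      rw [Polynomial.monomial_mul_monomial]
      simp only [spow_monomial, ← RingHom.coe_pow, map_zpow₀, zpow_mul, pow_add, RingHom.mul_def,
        RingHom.comp_apply]
      rw [← RingHom.comp_apply, ← RingHom.comp_apply, ← RingHom.mul_def, ← RingHom.mul_def,
        ← pow_add, ← pow_add, add_comm]

/-- `a ^ (g + h) = a ^ g * a ^ h` for exponents in `P[x]`. -/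
theorem spow_add (a : K) (g h : PX) :
    spow τ a ((g + h : PX) : Polynomial ℤ) = spow τ a g * spow τ a h := by
  rcases eq_or_ne a 0 with rfl | ha
  · rcases eq_or_ne g 0 with rfl | hg
    · simp
    have h1 : g + h ≠ 0 := fun h0 => hg (PX.add_eq_zero h0).1
    rw [zero_spow τ (g := (g : Polynomial ℤ)) (fun h0 => hg (Subtype.ext h0)),
      zero_spow τ (fun h0 => h1 (Subtype.ext h0)), zero_mul]
  · rw [Subsemiring.coe_add, spow_add_of_ne_zero τ ha]

theorem map_spow {L : Type u} [Field L] (τ' : L →+* L) (f : K →+* L)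
    (hf : ∀ a, f (τ a) = τ' (f a)) (a : K) (g : Polynomial ℤ) :
    f (spow τ a g) = spow τ' (f a) g := by
  have h : ∀ i : ℕ, ∀ b, f ((⇑τ)^[i] b) = (⇑τ')^[i] (f b) := fun i => by
    induction i with
    | zero => intro b; rfl
    | succ i ih => intro b; rw [Function.iterate_succ_apply, Function.iterate_succ_apply, ih, hf]
  simp only [spow, map_prod, map_zpow₀, h]

end spow

variable (k : Type u) [Field k] (σ : k →+* k)

/-- A difference field extension of the difference field `(k, σ)`. -/
structure SigmaExt where
  /-- the underlying field -/
  carrier : Type u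
  [field : Field carrier]
  [algebra : Algebra k carrier]
  /-- the difference operator -/
  τ : carrier →+* carrier
  comm : ∀ a : k, τ (algebraMap k carrier a) = algebraMap k carrier (σ a)

instance : CoeSort (SigmaExt k σ) (Type u) := ⟨SigmaExt.carrier⟩

attribute [instance] SigmaExt.field SigmaExt.algebra

variable {k σ}

/-- Morphisms of difference field extensions: `k`-algebra homomorphisms that commute with the
difference operators. -/
@[ext]
structure SigmaExt.Hom (K L : SigmaExt k σ) where
  /-- the underlying `k`-algebra homomorphism -/
  f : K →ₐ[k] L
  comm : ∀ a, f (K.τ a) = L.τ (f a)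

instance : Category (SigmaExt k σ) where
  Hom K L := SigmaExt.Hom K L
  id K := ⟨AlgHom.id k K, fun _ => rfl⟩
  comp f g := ⟨g.f.comp f.f, fun a => by simp [f.comm, g.comm]⟩

/-! ### `P[σ]`-polynomials and their zeros -/

variable (k) in
/-- The `P[σ]`-polynomial ring `k{y₁, …, yₘ}^{P[σ]}`: its elements are the `k`-linear combinations
of the `P[σ]`-monomials `Y ^ u`, `u ∈ P[x]^m`, with `Y ^ u * Y ^ v = Y ^ (u + v)`. -/
abbrev PPoly (m : ℕ) : Type u := AddMonoidAlgebra k (Fin m → PX)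

/-- The value `a ^ u = ∏ i, (a i) ^ (u i)` of the monomial `Y ^ u` at a point. -/
noncomputable def evalMon (K : SigmaExt k σ) {m : ℕ} (a : Fin m → K) (u : Fin m → PX) : K :=
  ∏ i, spow K.τ (a i) (u i)

/-- The value of a `P[σ]`-polynomial at a point. -/
noncomputable def evalAt (K : SigmaExt k σ) {m : ℕ} (a : Fin m → K) (f : PPoly k m) : K :=
  f.coeff.sum fun u c => algebraMap k K c * evalMon K a u

/-- A `P[σ]`-term: a constant times a `P[σ]`-monomial. -/
def IsPTerm {m : ℕ} (f : PPoly k m) : Prop :=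
  ∃ (c : k) (u : Fin m → PX), f = AddMonoidAlgebra.single u c

/-- `𝕍_K(F)`, the solutions of `F` in `K`. -/
def zeroLocus (K : SigmaExt k σ) {m : ℕ} (F : Set (PPoly k m)) : Set (Fin m → K) :=
  {a | ∀ f ∈ F, evalAt K a f = 0}

theorem evalAt_single (K : SigmaExt k σ) {m : ℕ} (a : Fin m → K) (u : Fin m → PX) (c : k) :
    evalAt K a (AddMonoidAlgebra.single u c) = algebraMap k K c * evalMon K a u := by
  simp [evalAt]

theorem map_evalMon {K L : SigmaExt k σ} (h : K ⟶ L) {m : ℕ} (a : Fin m → K)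
    (u : Fin m → PX) : h.f (evalMon K a u) = evalMon L (fun i => h.f (a i)) u := by
  simp only [evalMon, map_prod]
  exact Finset.prod_congr rfl fun i _ =>
    map_spow K.τ L.τ (h.f : K →+* L) (fun b => h.comm b) (a i) (u i)

theorem map_evalAt {K L : SigmaExt k σ} (h : K ⟶ L) {m : ℕ} (a : Fin m → K)
    (f : PPoly k m) : h.f (evalAt K a f) = evalAt L (fun i => h.f (a i)) f := by
  simp only [evalAt, Finsupp.sum, map_sum, map_mul, map_evalMon, AlgHom.commutes]

theorem evalMon_mul (K : SigmaExt k σ) {m : ℕ} (a b : Fin m → K) (u : Fin m → PX) :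
    evalMon K (a * b) u = evalMon K a u * evalMon K b u := by
  simp only [evalMon, Pi.mul_apply, mul_spow, Finset.prod_mul_distrib]

theorem evalMon_inv (K : SigmaExt k σ) {m : ℕ} (a : Fin m → K) (u : Fin m → PX) :
    evalMon K a⁻¹ u = (evalMon K a u)⁻¹ := by
  simp only [evalMon, Pi.inv_apply, inv_spow, Finset.prod_inv_distrib]

theorem evalMon_one (K : SigmaExt k σ) {m : ℕ} (u : Fin m → PX) :
    evalMon K (1 : Fin m → K) u = 1 := by
  simp [evalMon]

theorem evalMon_single (K : SigmaExt k σ) {m : ℕ} (a : Fin m → K) (i : Fin m) :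
    evalMon K a (Pi.single i 1) = a i := by
  classical
  rw [evalMon, Finset.prod_eq_single i]
  · rw [Pi.single_eq_same]
    have := spow_monomial K.τ (a i) 0 1
    simpa using this
  · intro j _ hj
    rw [Pi.single_eq_of_ne hj]
    simp
  · simp

/-! ### Affine `P[σ]`-varieties -/

variable (k σ) in
/-- An affine `P[σ]`-variety over `k`: a functor of the form `K ↦ 𝕍_K(F) ⊆ K ^ m` for a set `F` of
`P[σ]`-polynomials in `m` variables. The functor itself is `APVar.points`. -/
structure APVar where
  /-- the dimension of the ambient affine space -/
  m : ℕ
  /-- the `K`-points -/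
  pts : ∀ K : SigmaExt k σ, Set (Fin m → K)
  isVar : ∃ F : Set (PPoly k m), ∀ K, pts K = zeroLocus K F

theorem APVar.map_mem (X : APVar k σ) {K L : SigmaExt k σ} (h : K ⟶ L) {a : Fin X.m → K}
    (ha : a ∈ X.pts K) : (fun i => h.f (a i)) ∈ X.pts L := by
  obtain ⟨F, hF⟩ := X.isVar
  rw [hF] at ha ⊢
  intro f hf
  rw [← map_evalAt h, ha f hf, map_zero]

/-- The functor of points of an affine `P[σ]`-variety. -/
def APVar.points (X : APVar k σ) : SigmaExt k σ ⥤ Type u where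
  obj K := X.pts K
  map h := TypeCat.ofHom fun a => ⟨fun i => h.f (a.1 i), X.map_mem h a.2⟩

/-- A morphism of functors is a morphism of affine `P[σ]`-varieties if it is given by
`P[σ]`-terms in the coordinates. -/
def IsAPMorphism {X Y : APVar k σ} (η : X.points ⟶ Y.points) : Prop :=
  ∃ f : Fin Y.m → PPoly k X.m, (∀ j, IsPTerm (f j)) ∧
    ∀ (K : SigmaExt k σ) (a : X.pts K) (j : Fin Y.m), (η.app K a).1 j = evalAt K a.1 (f j)

theorem IsAPMorphism.id (X : APVar k σ) : IsAPMorphism (𝟙 X.points) := by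
  refine ⟨fun j => AddMonoidAlgebra.single (Pi.single j 1) 1, fun j => ⟨_, _, rfl⟩, ?_⟩
  intro K a j
  rw [evalAt_single, evalMon_single, map_one, one_mul]
  rfl

/-- Substituting terms in a term gives a term. -/
theorem IsPTerm.subst {m n : ℕ} {f : Fin n → PPoly k m} (hf : ∀ j, IsPTerm (f j))
    {g : PPoly k n} (hg : IsPTerm g) : ∃ h : PPoly k m, IsPTerm h ∧
      ∀ (K : SigmaExt k σ) (a : Fin m → K),
        evalAt K (fun j => evalAt K a (f j)) g = evalAt K a h := by
  obtain ⟨d, v, rfl⟩ := hg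
  choose c u hcu using hf
  refine ⟨AddMonoidAlgebra.single (fun i => ∑ j, u j i * v j)
    (d * ∏ j, spow σ (c j) (v j)), ⟨_, _, rfl⟩, fun K a => ?_⟩
  have hsum : ∀ (s : Finset (Fin n)) (b : K) (w : Fin n → PX),
      spow K.τ b ((∑ j ∈ s, w j : PX) : Polynomial ℤ) = ∏ j ∈ s, spow K.τ b (w j) := by
    classical
    intro s b w
    induction s using Finset.induction_on with
    | empty => simp
    | insert i s hi ih => rw [Finset.sum_insert hi, Finset.prod_insert hi, spow_add, ih]
  rw [evalAt_single, evalAt_single, map_mul, mul_assoc, map_prod]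
  congr 1
  simp only [evalMon]
  simp_rw [hcu, evalAt_single, mul_spow, evalMon, prod_spow, hsum, Subsemiring.coe_mul, spow_mul,
    Finset.prod_mul_distrib]
  rw [Finset.prod_comm (s := Finset.univ (α := Fin m))]
  congr 1
  exact Finset.prod_congr rfl fun j _ =>
    (map_spow σ K.τ (algebraMap k K) (fun b => (K.comm b).symm) _ _).symm

theorem IsAPMorphism.comp {X Y Z : APVar k σ} {η : X.points ⟶ Y.points} {θ : Y.points ⟶ Z.points}
    (hη : IsAPMorphism η) (hθ : IsAPMorphism θ) : IsAPMorphism (η ≫ θ) := by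
  obtain ⟨f, hf, hf'⟩ := hη
  obtain ⟨g, hg, hg'⟩ := hθ
  choose h hh hh' using fun j => IsPTerm.subst (σ := σ) hf (hg j)
  refine ⟨h, hh, fun K a j => ?_⟩
  have h1 : ((η ≫ θ).app K a).1 j = evalAt K (η.app K a).1 (g j) := hg' K (η.app K a) j
  have h2 : (η.app K a).1 = fun i => evalAt K a.1 (f i) := funext fun i => hf' K a i
  rw [h1, h2, hh']

/-- The category of affine `P[σ]`-varieties. -/
instance : Category (APVar k σ) where
  Hom X Y := {η : X.points ⟶ Y.points // IsAPMorphism η}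
  id X := ⟨𝟙 X.points, IsAPMorphism.id X⟩
  comp f g := ⟨f.1 ≫ g.1, f.2.comp g.2⟩

/-! ### Affine toric `P[σ]`-varieties -/

/-- The exponent of the monomial that arises from `Y ^ v` by substituting `T ^ (U i)` for `y i`. -/
noncomputable def expo {m n : ℕ} (U : Fin m → Fin n → Polynomial ℤ) (v : Fin m → PX) :
    Fin n → Polynomial ℤ :=
  ∑ i, v i • U i

variable (k) in
/-- `J_U`: the `P[σ]`-polynomials `f` such that `f(T ^ u₁, …, T ^ uₘ) = 0`, for difference
indeterminates `T = (t₁, …, tₙ)`; the values lie in `k{t₁^±1, …, tₙ^±1}`, which has the basis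
`T ^ w`, `w ∈ ℤ[x]^n`. -/
def toricIdeal {m n : ℕ} (U : Fin m → Fin n → Polynomial ℤ) : Set (PPoly k m) :=
  {f | AddMonoidAlgebra.mapDomain (expo U) f = 0}

/-- A point lies on `𝕍(J_U)` if and only if the values of monomials at this point only depend on
the monomials in `T` that result from the substitution. -/
theorem mem_zeroLocus_toricIdeal (K : SigmaExt k σ) {m n : ℕ} (U : Fin m → Fin n → Polynomial ℤ)
    (a : Fin m → K) : a ∈ zeroLocus K (toricIdeal k U) ↔
      ∀ v w : Fin m → PX, expo U v = expo U w → evalMon K a v = evalMon K a w := by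
  constructor
  · intro h v w hvw
    have hsub : ∀ f g : PPoly k m, evalAt K a (f + g) = evalAt K a f + evalAt K a g := by
      intro f g
      unfold evalAt
      rw [AddMonoidAlgebra.coeff_add]
      exact Finsupp.sum_add_index' (by simp) (by intros; simp [add_mul])
    have := h (AddMonoidAlgebra.single v 1 + AddMonoidAlgebra.single w (-1)) (by
      simp only [toricIdeal, Set.mem_ofPred_eq]
      rw [AddMonoidAlgebra.mapDomain_add, AddMonoidAlgebra.mapDomain_single,
        AddMonoidAlgebra.mapDomain_single, hvw, ← AddMonoidAlgebra.single_add]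
      simp)
    rw [hsub, evalAt_single, evalAt_single] at this
    simp only [map_one, one_mul, map_neg, neg_mul] at this
    exact sub_eq_zero.1 (by rw [sub_eq_add_neg]; exact this)
  · intro h f hf
    have hfac : Function.FactorsThrough (evalMon K a) (expo U) := fun v w hvw => h v w hvw
    obtain ⟨G, hG⟩ := (Function.factorsThrough_iff (evalMon K a)).1 hfac
    have h0 : (AddMonoidAlgebra.mapDomain (expo U) f).coeff.sum
        (fun w c => algebraMap k K c * G w) = 0 := by
      rw [show AddMonoidAlgebra.mapDomain (expo U) f = 0 from hf]
      simp
    rw [AddMonoidAlgebra.coeff_mapDomain, Finsupp.sum_mapDomain_index (by simp)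
      (by intros; simp [add_mul])] at h0
    rw [evalAt, hG]
    exact h0

variable (k σ) in
/-- An affine toric `P[σ]`-variety: an affine `P[σ]`-variety of the form `X_U = 𝕍(J_U)` for some
`U = (u₁, …, uₘ)`, `uᵢ ∈ ℤ[x]^n`. -/
structure ToricVar where
  /-- the underlying affine `P[σ]`-variety -/
  X : APVar k σ
  isToric : ∃ (n : ℕ) (U : Fin X.m → Fin n → Polynomial ℤ),
    ∀ K, X.pts K = zeroLocus K (toricIdeal k U)

/-- The difference torus `T = X ∩ (𝔸^*)^m` of an affine toric variety `X ⊆ 𝔸^m`, a group under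
multiplication of coordinates. -/
def ToricVar.torus (V : ToricVar k σ) (K : SigmaExt k σ) : Subgroup (Fin V.X.m → (K : Type u)ˣ)
    where
  carrier := {t | (fun i => (t i : K)) ∈ V.X.pts K}
  one_mem' := by
    obtain ⟨n, U, hU⟩ := V.isToric
    simp only [Set.mem_ofPred_eq, hU, mem_zeroLocus_toricIdeal]
    intro v w _
    exact (evalMon_one K v).trans (evalMon_one K w).symm
  mul_mem' := by
    intro s t hs ht
    obtain ⟨n, U, hU⟩ := V.isToric
    simp only [Set.mem_ofPred_eq, hU, mem_zeroLocus_toricIdeal] at hs ht ⊢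
    intro v w hvw
    have e : (fun i => (((s * t) i : (K : Type u)ˣ) : K)) =
      (fun i => (s i : K)) * (fun i => (t i : K)) := by ext i; simp
    rw [e, evalMon_mul, evalMon_mul, hs v w hvw, ht v w hvw]
  inv_mem' := by
    intro t ht
    obtain ⟨n, U, hU⟩ := V.isToric
    simp only [Set.mem_ofPred_eq, hU, mem_zeroLocus_toricIdeal] at ht ⊢
    intro v w hvw
    have e : (fun i => ((t⁻¹ i : (K : Type u)ˣ) : K)) = (fun i => (t i : K))⁻¹ := by ext i; simp
    rw [e, evalMon_inv, evalMon_inv, ht v w hvw]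

/-- The inclusion of the torus in the variety. -/
def ToricVar.torusIncl (V : ToricVar k σ) {K : SigmaExt k σ} (t : V.torus K) : V.X.pts K :=
  ⟨fun i => (t.1 i : K), t.2⟩

/-- A morphism is toric if it maps the torus to the torus and restricts to a group homomorphism
of the tori. (The restriction is a morphism of varieties because `φ` is one.) -/
def IsToric {V W : ToricVar k σ} (φ : V.X ⟶ W.X) : Prop :=
  ∃ ψ : ∀ K : SigmaExt k σ, V.torus K →* W.torus K,
    ∀ (K : SigmaExt k σ) (t : V.torus K), φ.1.app K (V.torusIncl t) = W.torusIncl (ψ K t)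

theorem IsToric.id (V : ToricVar k σ) : IsToric (V := V) (W := V) (𝟙 V.X) :=
  ⟨fun _ => MonoidHom.id _, fun _ _ => rfl⟩

theorem IsToric.comp {V W Z : ToricVar k σ} {φ : V.X ⟶ W.X} {χ : W.X ⟶ Z.X}
    (hφ : IsToric φ) (hχ : IsToric χ) : IsToric (V := V) (W := Z) (φ ≫ χ) := by
  obtain ⟨ψ, h⟩ := hφ
  obtain ⟨ψ', h'⟩ := hχ
  refine ⟨fun K => (ψ' K).comp (ψ K), fun K t => ?_⟩
  have h1 : (φ ≫ χ).1.app K (V.torusIncl t) = χ.1.app K (φ.1.app K (V.torusIncl t)) := rfl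
  rw [h1, h, h']
  rfl

/-- The category of affine toric `P[σ]`-varieties with toric morphisms. -/
instance : Category (ToricVar k σ) where
  Hom V W := {φ : V.X ⟶ W.X // IsToric φ}
  id V := ⟨𝟙 V.X, IsToric.id V⟩
  comp f g := ⟨f.1 ≫ g.1, f.2.comp g.2⟩

variable (k σ) in
/-- The functor that sends a toric variety to its functor of points. -/
def ToricVar.pointsFunctor : ToricVar k σ ⥤ (SigmaExt k σ ⥤ Type u) where
  obj V := V.X.points
  map φ := φ.1.1

/-! ### The semimodule algebra `k[S]` and its functor of points -/

variable (k) in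
/-- The semimodule algebra `k[S]` with basis `χ ^ u`, `u ∈ S`. -/
abbrev SAlg (M : AffSemimod) : Type u := AddMonoidAlgebra k M.S

variable (σ) in
/-- The difference operator of `k[S]`: it extends `σ` and maps `χ ^ u` to `χ ^ (x u)`. -/
noncomputable def SAlg.τ (M : AffSemimod) : SAlg k M →+* SAlg k M :=
  (AddMonoidAlgebra.mapDomainRingHom k (DistribSMul.toAddMonoidHom M.S PX.x)).comp
    (AddMonoidAlgebra.mapRingHom M.S σ)

theorem SAlg.τ_single (M : AffSemimod) (u : M.S) (c : k) :
    SAlg.τ σ M (AddMonoidAlgebra.single u c) = AddMonoidAlgebra.single (PX.x • u) (σ c) := by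
  simp [SAlg.τ]

variable (k) in
/-- The homomorphism `k[S] → k[S']`, `χ ^ u ↦ χ ^ (φ u)`, induced by a semimodule morphism `φ`. -/
noncomputable def SAlg.map {M N : AffSemimod} (φ : M ⟶ N) : SAlg k M →ₐ[k] SAlg k N :=
  AddMonoidAlgebra.mapDomainAlgHom k k (AffSemimod.toLin φ).toAddMonoidHom

theorem SAlg.map_single {M N : AffSemimod} (φ : M ⟶ N) (u : M.S) (c : k) :
    SAlg.map k φ (AddMonoidAlgebra.single u c) =
      AddMonoidAlgebra.single (AffSemimod.toLin φ u) c := by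
  simp [SAlg.map]

theorem SAlg.map_τ {M N : AffSemimod} (φ : M ⟶ N) (r : SAlg k M) :
    SAlg.map k φ (SAlg.τ σ M r) = SAlg.τ σ N (SAlg.map k φ r) := by
  induction r using AddMonoidAlgebra.induction_linear with
  | zero => simp
  | add f g hf hg => simp only [map_add, hf, hg]
  | single u c =>
    rw [SAlg.τ_single, SAlg.map_single, SAlg.map_single, SAlg.τ_single]
    congr 1
    exact (AffSemimod.toLin φ).map_smul _ _

theorem SAlg.map_id (M : AffSemimod) (r : SAlg k M) : SAlg.map k (𝟙 M) r = r := by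
  induction r using AddMonoidAlgebra.induction_linear with
  | zero => simp
  | add f g hf hg => simp only [map_add, hf, hg]
  | single u c =>
    rw [SAlg.map_single]
    rfl

theorem SAlg.map_comp {M N L : AffSemimod} (φ : M ⟶ N) (ψ : N ⟶ L) (r : SAlg k M) :
    SAlg.map k (φ ≫ ψ) r = SAlg.map k ψ (SAlg.map k φ r) := by
  induction r using AddMonoidAlgebra.induction_linear with
  | zero => simp
  | add f g hf hg => simp only [map_add, hf, hg]
  | single u c =>
    rw [SAlg.map_single, SAlg.map_single, SAlg.map_single]
    rfl

/-- The `K`-points of `Spec^{P[σ]}(k[S])`: the homomorphisms `k[S] → K` of `k`-algebras that commute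
with the difference operators. -/
def SpecPts (M : AffSemimod) (K : SigmaExt k σ) : Type u :=
  {f : SAlg k M →ₐ[k] K // ∀ r, f (SAlg.τ σ M r) = K.τ (f r)}

variable (k σ) in
/-- `S ↦ Spec^{P[σ]}(k[S])`, with values in functors of points. -/
noncomputable def specFunctor : AffSemimodᵒᵖ ⥤ (SigmaExt k σ ⥤ Type u) where
  obj M :=
    { obj := fun K => SpecPts M.unop K
      map := fun h => TypeCat.ofHom fun f => ⟨h.f.comp f.1, fun r => by
        simp [f.2 r, h.comm]⟩ }
  map φ :=
    { app := fun K => TypeCat.ofHom fun f => ⟨f.1.comp (SAlg.map k φ.unop), fun r => by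
        simp [SAlg.map_τ, f.2]⟩ }
  map_id M := by
    ext K f
    exact Subtype.ext (AlgHom.ext fun r => congrArg f.1 (SAlg.map_id M.unop r))
  map_comp φ ψ := by
    ext K f
    exact Subtype.ext (AlgHom.ext fun r => congrArg f.1 (SAlg.map_comp ψ.unop φ.unop r))

end PDiff

namespace PDiff

/-! ### Powers with exponents in `P[x]` -/

/-! Fix generators `s i` of S. By `mem_zeroLocus_toricIdeal`, a point `a` lies on 𝕍(J_s) exactly
when the value `a ^ v` depends only on the element `∑ v i • s i` of S. Such a point is therefore a
function χ on S with χ(0) = 1, χ(u + v) = χ(u)χ(v) and χ(xu) = σ(χ(u)), that is, a σ-homomorphism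
from k[S]. Evaluation at the generators recovers the point. For this one needs χ(gu) = χ(u)^g for
every `g` in P[x], although `g` may have negative lower coefficients; this is `SpecPts.chi_smul`.

Hence any toric variety with a presentation by S represents Spec k[S], and a semimodule morphism
acts by precomposition. In coordinates this action is by monomials, so it is a toric morphism.

Full faithfulness is tested at one point. The ring k[S] is a domain with injective σ, so its
fraction field is a σ-extension of k, and at the tautological point the values χ^u are pairwise
distinct (`genericPt_chi_injective`). A morphism thus determines the images of the generators.
Conversely, a toric morphism preserves the unit of the torus, so its terms have coefficient 1 in
each K. Their exponents define images of the generators, and the equations of the target, read at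
the generic point, say that these images respect all relations. Essential surjectivity holds because
𝕍(J_U) is presented by the span of U. -/

/-- In positive degree, subtracting 1 does not change the leading coefficient; in degree 0, a
positive integer is at least 1. -/
theorem PX.exists_eq_add_one {g : PX} (hg : g ≠ 0) : ∃ h : PX, g = h + 1 := by
  have hg' : (g : Polynomial ℤ) ≠ 0 := fun h => hg (Subtype.ext h)
  have hpos : 0 < (g : Polynomial ℤ).leadingCoeff :=
    lt_of_le_of_ne g.2 (Ne.symm (Polynomial.leadingCoeff_ne_zero.2 hg'))
  refine ⟨⟨(g : Polynomial ℤ) - 1, ?_⟩, Subtype.ext (by simp)⟩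
  change 0 ≤ ((g : Polynomial ℤ) - 1).leadingCoeff
  rcases Nat.eq_zero_or_pos (g : Polynomial ℤ).natDegree with h0 | h0
  · obtain ⟨c, hc⟩ := Polynomial.natDegree_eq_zero.1 h0
    rw [← hc] at hpos ⊢
    rw [Polynomial.leadingCoeff_C] at hpos
    rw [← Polynomial.C_1, ← Polynomial.C_sub, Polynomial.leadingCoeff_C]
    omega
  · rw [Polynomial.leadingCoeff_sub_of_degree_lt]
    · exact hpos.le
    · rw [Polynomial.degree_one]
      exact Polynomial.natDegree_pos_iff_degree_pos.1 h0

theorem spow_one {K : Type u} [Field K] (τ : K →+* K) (a : K) : spow τ a 1 = a := by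
  simpa using spow_monomial τ a 0 1

theorem spow_X {K : Type u} [Field K] (τ : K →+* K) (a : K) : spow τ a Polynomial.X = τ a := by
  simpa [Polynomial.monomial_one_one_eq_X] using spow_monomial τ a 1 1

/-- A polynomial with integer coefficients is a difference of polynomials with natural
coefficients. -/
theorem exists_add_map_natCast_eq (g : Polynomial ℤ) :
    ∃ p q : Polynomial ℕ, g + q.map (Nat.castRingHom ℤ) = p.map (Nat.castRingHom ℤ) := by
  induction g using Polynomial.induction_on' with
  | add f g hf hg =>
    obtain ⟨p, q, h⟩ := hf
    obtain ⟨p', q', h'⟩ := hg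
    refine ⟨p + p', q + q', ?_⟩
    rw [Polynomial.map_add, Polynomial.map_add, ← h, ← h']
    ring
  | monomial i c =>
    refine ⟨Polynomial.monomial i c.toNat, Polynomial.monomial i (-c).toNat, ?_⟩
    rw [Polynomial.map_monomial, Polynomial.map_monomial, ← map_add]
    congr 1
    simp only [eq_natCast]
    omega

theorem map_natCast_mem_PX (p : Polynomial ℕ) : p.map (Nat.castRingHom ℤ) ∈ PX := by
  change 0 ≤ (p.map (Nat.castRingHom ℤ)).leadingCoeff
  rw [Polynomial.leadingCoeff, Polynomial.coeff_map]
  exact Int.natCast_nonneg _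

variable {k : Type u} [Field k] {σ : k →+* k}

theorem SigmaExt.evalMon_add (K : SigmaExt k σ) {m : ℕ} (a : Fin m → K) (u v : Fin m → PX) :
    evalMon K a (u + v) = evalMon K a u * evalMon K a v := by
  simp only [evalMon, Pi.add_apply, spow_add, Finset.prod_mul_distrib]

theorem SigmaExt.evalMon_zero (K : SigmaExt k σ) {m : ℕ} (a : Fin m → K) :
    evalMon K a 0 = 1 := by
  simp [evalMon]

theorem SigmaExt.evalMon_x_smul (K : SigmaExt k σ) {m : ℕ} (a : Fin m → K) (u : Fin m → PX) :
    evalMon K a (PX.x • u) = K.τ (evalMon K a u) := by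
  simp only [evalMon, map_prod]
  refine Finset.prod_congr rfl fun i _ => ?_
  rw [← spow_X K.τ (spow _ _ _), ← spow_mul]
  congr 1
  exact mul_comm _ _

/-! ### Points of the spectrum -/

namespace SpecPts

variable {M : AffSemimod} {K : SigmaExt k σ}

/-- The value of a point at the basis element `χ ^ s`. -/
noncomputable def chi (f : SpecPts M K) (s : M.S) : K := f.1 (AddMonoidAlgebra.single s 1)

theorem ext_chi {f g : SpecPts M K} (h : ∀ s, f.chi s = g.chi s) : f = g :=
  Subtype.ext (AddMonoidAlgebra.algHom_ext h (by ext))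

theorem chi_zero (f : SpecPts M K) : f.chi 0 = 1 := map_one f.1

theorem chi_add (f : SpecPts M K) (s t : M.S) : f.chi (s + t) = f.chi s * f.chi t := by
  simp only [chi, ← map_mul, AddMonoidAlgebra.single_mul_single, mul_one]

theorem chi_x_smul (f : SpecPts M K) (s : M.S) : f.chi (PX.x • s) = K.τ (f.chi s) := by
  rw [chi, chi, ← f.2, SAlg.τ_single, map_one]

/-- Natural coefficients are reached from 0 and 1 by sums and multiplication by `x`, which a point
respects by definition. Nothing is divided, so a zero value is allowed. -/
theorem chi_map_natCast_smul (f : SpecPts M K) (p : Polynomial ℕ) (s : M.S) :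
    f.chi ((⟨p.map (Nat.castRingHom ℤ), map_natCast_mem_PX p⟩ : PX) • s) =
      spow K.τ (f.chi s) (p.map (Nat.castRingHom ℤ)) := by
  induction p using Polynomial.induction_on with
  | C n =>
    induction n with
    | zero =>
      have : (⟨_, map_natCast_mem_PX (Polynomial.C 0)⟩ : PX) = 0 := Subtype.ext (by simp)
      rw [this, zero_smul, chi_zero]
      simp
    | succ n ih =>
      have : (⟨_, map_natCast_mem_PX (Polynomial.C (n + 1))⟩ : PX) =
        ⟨_, map_natCast_mem_PX (Polynomial.C n)⟩ + 1 := Subtype.ext (by simp)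
      have h := spow_add K.τ (f.chi s) ⟨_, map_natCast_mem_PX (Polynomial.C n)⟩ 1
      rw [← this] at h
      rw [this, add_smul, one_smul, chi_add, ih]
      refine (h.trans ?_).symm
      congr 1
      exact spow_one _ _
  | add p q hp hq =>
    have : (⟨_, map_natCast_mem_PX (p + q)⟩ : PX) =
      ⟨_, map_natCast_mem_PX p⟩ + ⟨_, map_natCast_mem_PX q⟩ := Subtype.ext (by simp)
    have h := spow_add K.τ (f.chi s) ⟨_, map_natCast_mem_PX p⟩ ⟨_, map_natCast_mem_PX q⟩
    rw [← this] at h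
    rw [this, add_smul, chi_add, hp, hq]
    exact h.symm
  | monomial n c ih =>
    have : (⟨_, map_natCast_mem_PX (Polynomial.C c * Polynomial.X ^ (n + 1))⟩ : PX) =
      PX.x * ⟨_, map_natCast_mem_PX (Polynomial.C c * Polynomial.X ^ n)⟩ :=
        Subtype.ext (by simp [PX.x]; ring)
    rw [this, mul_smul, chi_x_smul, ih, ← spow_X, ← spow_mul]
    congr 1
    simp
    ring

/-- If `f(χ ^ s) = 0` and `g ≠ 0` then `g = h + 1` in `P[x]`, which gives the case that does not
follow by division. -/
theorem chi_smul (f : SpecPts M K) (g : PX) (s : M.S) :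
    f.chi (g • s) = spow K.τ (f.chi s) g := by
  rcases eq_or_ne g 0 with rfl | hg
  · rw [zero_smul, chi_zero]
    simp
  rcases eq_or_ne (f.chi s) 0 with hs | hs
  · rw [hs, zero_spow K.τ (fun h => hg (Subtype.ext h))]
    obtain ⟨h, rfl⟩ := PX.exists_eq_add_one hg
    rw [add_smul, one_smul, chi_add, hs, mul_zero]
  -- Write `g + q = p` with natural coefficients in `p` and `q`, compare the values at both sides,
  -- and cancel the nonzero power with exponent `q`.
  · obtain ⟨p, q, hpq⟩ := exists_add_map_natCast_eq (g : Polynomial ℤ)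
    have hsum : g + ⟨_, map_natCast_mem_PX q⟩ = ⟨_, map_natCast_mem_PX p⟩ := Subtype.ext hpq
    have h1 := f.chi_map_natCast_smul p s
    rw [← hsum, add_smul, chi_add, chi_map_natCast_smul, ← hpq, spow_add_of_ne_zero _ hs] at h1
    exact mul_right_cancel₀ (spow_ne_zero _ hs _) h1

theorem chi_sum_smul (f : SpecPts M K) {m : ℕ} (v : Fin m → PX) (s : Fin m → M.S) :
    f.chi (∑ i, v i • s i) = evalMon K (fun i => f.chi (s i)) v := by
  have h : ∀ (t : Finset (Fin m)) (r : Fin m → M.S),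
      f.chi (∑ i ∈ t, r i) = ∏ i ∈ t, f.chi (r i) := by
    classical
    intro t r
    induction t using Finset.induction_on with
    | empty => simp [chi_zero]
    | insert i t hi ih => rw [Finset.sum_insert hi, Finset.prod_insert hi, chi_add, ih]
  rw [h]
  exact Finset.prod_congr rfl fun i _ => f.chi_smul _ _

/-- A multiplicative function on `S` that is compatible with `σ` defines a point. -/
noncomputable def ofFun (F : M.S → K) (h0 : F 0 = 1) (hadd : ∀ s t, F (s + t) = F s * F t)
    (hx : ∀ s, F (PX.x • s) = K.τ (F s)) : SpecPts M K :=
  ⟨AddMonoidAlgebra.lift k K M.S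
    { toFun := fun s => F s.toAdd, map_one' := h0, map_mul' := fun s t => hadd s.toAdd t.toAdd },
    fun r => by
      induction r using AddMonoidAlgebra.induction_linear with
      | zero => simp
      | add f g hf hg => simp only [map_add, hf, hg]
      | single s c =>
        rw [SAlg.τ_single, AddMonoidAlgebra.lift_single, AddMonoidAlgebra.lift_single]
        simp only [Algebra.smul_def, map_mul, K.comm]
        congr 1
        exact hx s⟩

theorem chi_ofFun (F : M.S → K) (h0 hadd hx) (s : M.S) :
    (ofFun (K := K) F h0 hadd hx).chi s = F s := by
  rw [chi, ofFun, AddMonoidAlgebra.lift_single, one_smul]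
  rfl

end SpecPts

/-! ### The generic point -/

/-- Taking coefficients embeds S additively in a product of copies of ℤ, which has unique sums. This
is what makes k[S] a domain. -/
instance (M : AffSemimod) : UniqueSums M.S :=
  UniqueSums.of_injective_addHom
    { toFun := fun (u : M.S) (i : Fin M.n) (j : ℕ) => (u.1 i).coeff j
      map_add' := fun u v => by
        ext i j
        exact Polynomial.coeff_add _ _ _ }
    (fun u v h => Subtype.ext (funext fun i => Polynomial.ext fun j => congrFun (congrFun h i) j))
    inferInstance

instance (M : AffSemimod) : IsDomain (SAlg k M) :=
  NoZeroDivisors.to_isDomain _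

variable (σ) in
-- Multiplication by `x` is injective on ℤ[x]^n and σ is injective on the field k. Injectivity is
-- needed to extend the operator to fractions.
theorem SAlg.τ_injective (M : AffSemimod) : Function.Injective (SAlg.τ σ M) := by
  have h : Function.Injective fun u : M.S => PX.x • u := by
    intro u v huv
    refine Subtype.ext (funext fun i => ?_)
    have := congrFun (congrArg Subtype.val huv) i
    exact mul_left_cancel₀ Polynomial.X_ne_zero this
  rw [SAlg.τ, RingHom.coe_comp]
  exact (AddMonoidAlgebra.mapDomain_injective h).comp
    (AddMonoidAlgebra.map_injective (σ : k →+ k) σ.injective)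

variable (k σ) in
/-- The fraction field of `k[S]`, as a difference field extension of `k`. -/
noncomputable def genericExt (M : AffSemimod) : SigmaExt k σ where
  carrier := FractionRing (SAlg k M)
  τ := IsFractionRing.map (SAlg.τ_injective σ M)
  comm a := by
    have h : ∀ b : k, algebraMap k (SAlg k M) b = AddMonoidAlgebra.single 0 b := fun _ => rfl
    rw [IsScalarTower.algebraMap_apply k (SAlg k M) (FractionRing (SAlg k M)),
      IsScalarTower.algebraMap_apply k (SAlg k M) (FractionRing (SAlg k M)),
      IsFractionRing.map, IsLocalization.map_eq, h, h, SAlg.τ_single, smul_zero]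

variable (k σ) in
/-- The point of `Spec k[S]` given by the inclusion of `k[S]` in its fraction field. -/
noncomputable def genericPt (M : AffSemimod) : SpecPts M (genericExt k σ M) :=
  ⟨IsScalarTower.toAlgHom k (SAlg k M) (FractionRing (SAlg k M)), fun r => by
    change algebraMap (SAlg k M) (FractionRing (SAlg k M)) (SAlg.τ σ M r) =
      IsFractionRing.map (K := FractionRing (SAlg k M)) (L := FractionRing (SAlg k M))
        (SAlg.τ_injective σ M) (algebraMap (SAlg k M) (FractionRing (SAlg k M)) r)
    rw [IsFractionRing.map, IsLocalization.map_eq]⟩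

variable (k σ) in
-- Elements of S can be compared by their values at this single point; both halves of full
-- faithfulness rest on it.
theorem genericPt_chi_injective (M : AffSemimod) :
    Function.Injective (genericPt k σ M).chi := by
  intro u v h
  have h' : AddMonoidAlgebra.single u (1 : k) = AddMonoidAlgebra.single v 1 :=
    IsFractionRing.injective (SAlg k M) (FractionRing (SAlg k M)) h
  exact AddMonoidAlgebra.single_left_injective one_ne_zero h'

/-! ### Toric varieties and generators of semimodules -/

/-- A family of generators `s` of `S` such that `V = 𝕍(J_s)`. -/
structure ToricVar.Presentation (V : ToricVar k σ) (M : AffSemimod) where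
  /-- the generators -/
  s : Fin V.X.m → M.S
  exists_sum : ∀ u : M.S, ∃ v : Fin V.X.m → PX, ∑ i, v i • s i = u
  pts_eq : ∀ K, V.X.pts K = zeroLocus K (toricIdeal k fun i => (s i : Fin M.n → Polynomial ℤ))

namespace ToricVar.Presentation

variable {V W : ToricVar k σ} {M N : AffSemimod}

/-- The equations of V are the relations among the generators inside S, so the ambient ℤ[x]^n drops
out. -/
theorem mem_pts_iff (P : V.Presentation M) (K : SigmaExt k σ) (a : Fin V.X.m → K) :
    a ∈ V.X.pts K ↔ ∀ v w : Fin V.X.m → PX, ∑ i, v i • P.s i = ∑ i, w i • P.s i →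
      evalMon K a v = evalMon K a w := by
  have h : ∀ v : Fin V.X.m → PX, expo (fun i => (P.s i : Fin M.n → Polynomial ℤ)) v =
      ((∑ i, v i • P.s i : M.S) : Fin M.n → Polynomial ℤ) := fun v => by
    rw [expo, AddSubmonoidClass.coe_finsetSum]
    rfl
  rw [P.pts_eq, mem_zeroLocus_toricIdeal]
  simp only [h, Subtype.coe_inj]

/-- The exponents of an element of `S` with respect to the generators. -/
noncomputable def coords (P : V.Presentation M) (u : M.S) : Fin V.X.m → PX :=
  (P.exists_sum u).choose

theorem sum_coords (P : V.Presentation M) (u : M.S) : ∑ i, P.coords u i • P.s i = u :=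
  (P.exists_sum u).choose_spec

/-- The point of `Spec k[S]` given by a point of `V`. -/
noncomputable def toSpec (P : V.Presentation M) {K : SigmaExt k σ} (a : V.X.pts K) :
    SpecPts M K :=
  have h := (P.mem_pts_iff K a.1).1 a.2
  -- The chosen exponents need not be additive in `u` or compatible with `x`. By `h`, any two
  -- exponent vectors of the same element give the same value at `a`, and this yields all three
  -- conditions.
  SpecPts.ofFun (fun u => evalMon K a.1 (P.coords u))
    (by
      rw [← SigmaExt.evalMon_zero K a.1]
      apply h
      rw [sum_coords]
      simp)
    (fun u v => by
      rw [← SigmaExt.evalMon_add]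
      apply h
      simp only [Pi.add_apply, add_smul, Finset.sum_add_distrib, sum_coords])
    (fun u => by
      rw [← SigmaExt.evalMon_x_smul]
      apply h
      simp only [Pi.smul_apply, smul_assoc, ← Finset.smul_sum, sum_coords])

theorem chi_toSpec (P : V.Presentation M) {K : SigmaExt k σ} (a : V.X.pts K)
    (v : Fin V.X.m → PX) : (P.toSpec a).chi (∑ i, v i • P.s i) = evalMon K a.1 v := by
  rw [toSpec, SpecPts.chi_ofFun]
  exact (P.mem_pts_iff K a.1).1 a.2 _ _ (P.sum_coords _)

theorem chi_toSpec_s (P : V.Presentation M) {K : SigmaExt k σ} (a : V.X.pts K)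
    (i : Fin V.X.m) : (P.toSpec a).chi (P.s i) = a.1 i := by
  rw [← evalMon_single K a.1 i, ← P.chi_toSpec a]
  congr 1
  simp [Pi.single_apply]

/-- The point of `V` given by a point of `Spec k[S]`. -/
noncomputable def ofSpec (P : V.Presentation M) {K : SigmaExt k σ} (f : SpecPts M K) :
    V.X.pts K :=
  ⟨fun i => f.chi (P.s i), (P.mem_pts_iff K _).2 fun v w h => by
    rw [← f.chi_sum_smul, ← f.chi_sum_smul, h]⟩

theorem ofSpec_toSpec (P : V.Presentation M) {K : SigmaExt k σ} (a : V.X.pts K) :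
    P.ofSpec (P.toSpec a) = a :=
  Subtype.ext (funext fun i => P.chi_toSpec_s a i)

theorem toSpec_ofSpec (P : V.Presentation M) {K : SigmaExt k σ} (f : SpecPts M K) :
    P.toSpec (P.ofSpec f) = f := by
  refine SpecPts.ext_chi fun u => ?_
  rw [← P.sum_coords u, chi_toSpec, f.chi_sum_smul]
  rfl

/-- `V` represents the same functor as `Spec k[S]`. -/
noncomputable def iso (P : V.Presentation M) :
    V.X.points ≅ (specFunctor k σ).obj (op M) :=
  -- Built from Spec to V: evaluation at the generators is natural by definition, whereas the
  -- inverse involves chosen exponents.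
  Iso.symm <| NatIso.ofComponents
    (fun K => (show SpecPts M K ≃ V.X.pts K from
      { toFun := P.ofSpec
        invFun := P.toSpec
        left_inv := P.toSpec_ofSpec
        right_inv := P.ofSpec_toSpec }).toIso)
    (fun _ => rfl)

/-- The transformation `V → W` of functors of points that corresponds to `N → M`. -/
noncomputable def mapPoints (P : V.Presentation M) (Q : W.Presentation N) (φ : N ⟶ M) :
    V.X.points ⟶ W.X.points :=
  P.iso.hom ≫ (specFunctor k σ).map φ.op ≫ Q.iso.inv

theorem mapPoints_comp_iso_hom (P : V.Presentation M) (Q : W.Presentation N) (φ : N ⟶ M) :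
    P.mapPoints Q φ ≫ Q.iso.hom = P.iso.hom ≫ (specFunctor k σ).map φ.op := by
  simp [mapPoints]

theorem mapPoints_app (P : V.Presentation M) (Q : W.Presentation N) (φ : N ⟶ M)
    {K : SigmaExt k σ} (a : V.X.pts K) (j : Fin W.X.m) :
    ((P.mapPoints Q φ).app K a).1 j = (P.toSpec a).chi (AffSemimod.toLin φ (Q.s j)) :=
  congrArg (P.toSpec a).1 (SAlg.map_single φ (Q.s j) 1)

theorem mapPoints_app_eq_evalMon (P : V.Presentation M) (Q : W.Presentation N) (φ : N ⟶ M)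
    {K : SigmaExt k σ} (a : V.X.pts K) (j : Fin W.X.m) :
    ((P.mapPoints Q φ).app K a).1 j =
      evalMon K a.1 (P.coords (AffSemimod.toLin φ (Q.s j))) := by
  rw [mapPoints_app, ← chi_toSpec, sum_coords]

theorem isAPMorphism_mapPoints (P : V.Presentation M) (Q : W.Presentation N) (φ : N ⟶ M) :
    IsAPMorphism (P.mapPoints Q φ) :=
  ⟨fun j => AddMonoidAlgebra.single (P.coords (AffSemimod.toLin φ (Q.s j))) 1,
    fun _ => ⟨_, _, rfl⟩, fun K a j => by
      rw [mapPoints_app_eq_evalMon, evalAt_single, map_one, one_mul]⟩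

/-- Monomials with coefficient 1 are multiplicative in the point and do not vanish where all
coordinates are nonzero. -/
theorem isToric_mapPoints (P : V.Presentation M) (Q : W.Presentation N) (φ : N ⟶ M) :
    IsToric (V := V) (W := W) ⟨P.mapPoints Q φ, P.isAPMorphism_mapPoints Q φ⟩ := by
  have hne : ∀ (K : SigmaExt k σ) (t : V.torus K) (j : Fin W.X.m),
      ((P.mapPoints Q φ).app K (V.torusIncl t)).1 j ≠ 0 := fun K t j => by
    rw [mapPoints_app_eq_evalMon]
    exact Finset.prod_ne_zero_iff.2 fun i _ => spow_ne_zero _ (t.1 i).ne_zero _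
  refine ⟨fun K => MonoidHom.mk' (fun t => ⟨fun j => Units.mk0 _ (hne K t j),
    ((P.mapPoints Q φ).app K (V.torusIncl t)).2⟩) fun t t' => ?_, fun K t => rfl⟩
  refine Subtype.ext (funext fun j => Units.ext ?_)
  change ((P.mapPoints Q φ).app K (V.torusIncl (t * t'))).1 j =
    ((P.mapPoints Q φ).app K (V.torusIncl t)).1 j * ((P.mapPoints Q φ).app K (V.torusIncl t')).1 j
  simp only [mapPoints_app_eq_evalMon, ← evalMon_mul]
  rfl

/-- The toric morphism `V ⟶ W` that corresponds to `N ⟶ M`. -/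
noncomputable def map (P : V.Presentation M) (Q : W.Presentation N) (φ : N ⟶ M) : V ⟶ W :=
  ⟨⟨P.mapPoints Q φ, P.isAPMorphism_mapPoints Q φ⟩, P.isToric_mapPoints Q φ⟩

end ToricVar.Presentation

theorem ToricVar.hom_ext {V W : ToricVar k σ} {f g : V ⟶ W} (h : f.1.1 = g.1.1) : f = g :=
  Subtype.ext (Subtype.ext h)

/-! ### Functoriality and full faithfulness for presented varieties -/

namespace ToricVar.Presentation

variable {V W : ToricVar k σ} {M N : AffSemimod}

theorem map_id (P : V.Presentation M) : P.map P (𝟙 M) = 𝟙 V := by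
  apply ToricVar.hom_ext
  change P.iso.hom ≫ (specFunctor k σ).map (𝟙 (op M)) ≫ P.iso.inv = 𝟙 _
  simp

theorem map_comp {Z : ToricVar k σ} {L : AffSemimod} (P : V.Presentation M)
    (Q : W.Presentation N) (R : Z.Presentation L) (φ : N ⟶ M) (ψ : L ⟶ N) :
    P.map R (ψ ≫ φ) = P.map Q φ ≫ Q.map R ψ := by
  apply ToricVar.hom_ext
  change P.iso.hom ≫ (specFunctor k σ).map (φ.op ≫ ψ.op) ≫ R.iso.inv =
    (P.iso.hom ≫ (specFunctor k σ).map φ.op ≫ Q.iso.inv) ≫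
      Q.iso.hom ≫ (specFunctor k σ).map ψ.op ≫ R.iso.inv
  simp

/-- Two toric varieties with presentations of the same semimodule are isomorphic. -/
noncomputable def isoOfPresentations (P : V.Presentation M) (Q : W.Presentation M) : V ≅ W where
  hom := P.map Q (𝟙 M)
  inv := Q.map P (𝟙 M)
  hom_inv_id := by rw [← map_comp, Category.comp_id, map_id]
  inv_hom_id := by rw [← map_comp, Category.comp_id, map_id]

theorem hom_ext (Q : W.Presentation N) {φ ψ : N ⟶ M}
    (h : ∀ j, AffSemimod.toLin φ (Q.s j) = AffSemimod.toLin ψ (Q.s j)) : φ = ψ := by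
  refine LinearMap.ext fun u => ?_
  change AffSemimod.toLin φ u = AffSemimod.toLin ψ u
  rw [← Q.sum_coords u]
  simp only [map_sum, map_smul, h]

/-- At the generic point of V, the `j`-th coordinate of the image is χ^u with `u` the image of the
`j`-th generator, so the morphism determines `u`. -/
theorem map_injective (P : V.Presentation M) (Q : W.Presentation N) :
    Function.Injective (P.map Q) := by
  intro φ ψ h
  refine Q.hom_ext fun j => genericPt_chi_injective k σ M ?_
  have h' : P.mapPoints Q φ = P.mapPoints Q ψ := congrArg (fun f : V ⟶ W => f.1.1) h
  have := P.mapPoints_app Q φ (P.ofSpec (genericPt k σ M)) j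
  rw [h', mapPoints_app, toSpec_ofSpec] at this
  exact this.symm

/-- A map on generators that respects relations extends to the semimodule. -/
theorem exists_hom (Q : W.Presentation N) (r : Fin W.X.m → M.S)
    (hr : ∀ v w : Fin W.X.m → PX, ∑ j, v j • Q.s j = ∑ j, w j • Q.s j →
      ∑ j, v j • r j = ∑ j, w j • r j) :
    ∃ φ : N ⟶ M, ∀ j, AffSemimod.toLin φ (Q.s j) = r j := by
  let φ : N.S →ₗ[PX] M.S :=
    { toFun := fun u => ∑ j, Q.coords u j • r j
      map_add' := fun u v => by
        rw [← Finset.sum_add_distrib]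
        simp only [← add_smul]
        apply hr (Q.coords (u + v)) (Q.coords u + Q.coords v)
        simp only [Pi.add_apply, add_smul, Finset.sum_add_distrib, sum_coords]
      map_smul' := fun g u => by
        rw [RingHom.id_apply, Finset.smul_sum]
        simp only [← mul_smul]
        apply hr (Q.coords (g • u)) (fun j => g * Q.coords u j)
        simp only [mul_smul, ← Finset.smul_sum, sum_coords] }
  refine ⟨φ, fun j => ?_⟩
  -- The chosen exponents of a generator may differ from the standard basis vector, but both
  -- represent it, so `hr` applies.
  have := hr (Q.coords (Q.s j)) (Pi.single j 1) (by
    rw [sum_coords]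
    simp [Pi.single_apply])
  refine this.trans ?_
  simp [Pi.single_apply]

/-- A toric morphism is given by monomials, since it preserves the unit of the torus. -/
theorem _root_.PDiff.IsToric.exists_evalMon {φ : V.X ⟶ W.X} (h : IsToric (V := V) (W := W) φ) :
    ∃ w : Fin W.X.m → Fin V.X.m → PX, ∀ (K : SigmaExt k σ) (a : V.X.pts K) (j : Fin W.X.m),
      (φ.1.app K a).1 j = evalMon K a.1 (w j) := by
  obtain ⟨f, hf, hφ⟩ := φ.2
  obtain ⟨ψ, hψ⟩ := h
  choose c w hcw using hf
  refine ⟨w, fun K a j => ?_⟩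
  -- At the unit of the torus every monomial is 1, so the `j`-th term takes its coefficient as value
  -- there.
  have h1 : (φ.1.app K (V.torusIncl 1)).1 j = 1 := by
    rw [hψ, map_one]
    rfl
  have hone : (V.torusIncl (1 : V.torus K)).1 = 1 := rfl
  rw [hφ, hcw, evalAt_single, hone, evalMon_one, mul_one] at h1
  rw [hφ, hcw, evalAt_single, h1, one_mul]

theorem map_surjective (P : V.Presentation M) (Q : W.Presentation N) :
    Function.Surjective (P.map Q) := by
  intro φ
  obtain ⟨w, hw⟩ := φ.2.exists_evalMon
  have hchi : ∀ (K : SigmaExt k σ) (a : V.X.pts K) (j : Fin W.X.m),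
      (φ.1.1.app K a).1 j = (P.toSpec a).chi (∑ i, w j i • P.s i) := fun K a j => by
    rw [hw, chi_toSpec]
  -- The exponents of φ suggest where each generator of N should go. A relation among these
  -- generators is an equation of W; since φ maps the generic point of V into W, the two sides have
  -- equal values there, hence are equal in M.
  obtain ⟨ψ, hψ⟩ := Q.exists_hom (fun j => ∑ i, w j i • P.s i) (fun v v' hv => by
    apply genericPt_chi_injective k σ M
    rw [SpecPts.chi_sum_smul, SpecPts.chi_sum_smul]
    have := (Q.mem_pts_iff _ _).1 (φ.1.1.app _ (P.ofSpec (genericPt k σ M))).2 v v' hv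
    have e : (φ.1.1.app _ (P.ofSpec (genericPt k σ M))).1 = _ := funext (hchi _ _)
    rw [toSpec_ofSpec] at e
    rwa [e] at this)
  refine ⟨ψ, ToricVar.hom_ext ?_⟩
  ext K a
  refine Subtype.ext (funext fun j => ?_)
  exact (P.mapPoints_app Q ψ a j).trans ((congrArg _ (hψ j)).trans (hchi K a j).symm)

end ToricVar.Presentation

/-! ### The antiequivalence -/

theorem AffSemimod.exists_fin_generators (M : AffSemimod) :
    ∃ (m : ℕ) (s : Fin m → M.S), ∀ u : M.S, ∃ v : Fin m → PX, ∑ i, v i • s i = u := by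
  have := Module.Finite.iff_fg.2 M.fg
  obtain ⟨m, s, hs⟩ := Module.Finite.exists_fin (R := PX) (M := M.S)
  exact ⟨m, s, Submodule.top_le_span_range_iff_forall_exists_fun PX |>.1 hs.ge⟩

/-- The size of a chosen generating family. -/
noncomputable def AffSemimod.numGens (M : AffSemimod) : ℕ := M.exists_fin_generators.choose

/-- A chosen generating family. -/
noncomputable def AffSemimod.gens (M : AffSemimod) : Fin M.numGens → M.S :=
  M.exists_fin_generators.choose_spec.choose

variable (k σ) in
/-- The affine toric variety `X_S`, for a chosen generating family of `S`. -/
noncomputable def AffSemimod.toricVar (M : AffSemimod) : ToricVar k σ where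
  X := ⟨M.numGens, fun K => zeroLocus K (toricIdeal k fun i => (M.gens i).1), _, fun _ => rfl⟩
  isToric := ⟨M.n, _, fun _ => rfl⟩

variable (k σ) in
/-- The defining presentation of `X_S`. -/
noncomputable def AffSemimod.presentation (M : AffSemimod) :
    (M.toricVar k σ).Presentation M where
  s := M.gens
  exists_sum := M.exists_fin_generators.choose_spec.choose_spec
  pts_eq _ := rfl

/-- Take for S the P[x]-span of the exponent vectors U; the ideal of the presentation is then J_U
itself. -/
theorem ToricVar.exists_presentation (V : ToricVar k σ) :
    ∃ M, Nonempty (V.Presentation M) := by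
  obtain ⟨n, U, hU⟩ := V.isToric
  have hspan : ∀ i, U i ∈ Submodule.span PX (Set.range U) := fun i =>
    Submodule.subset_span ⟨i, rfl⟩
  refine ⟨⟨n, Submodule.span PX (Set.range U), Submodule.fg_span (Set.finite_range U)⟩,
    ⟨⟨fun i => ⟨U i, hspan i⟩, fun u => ?_, hU⟩⟩⟩
  obtain ⟨v, hv⟩ := (Submodule.mem_span_range_iff_exists_fun PX).1 u.2
  refine ⟨v, Subtype.ext ?_⟩
  rw [AddSubmonoidClass.coe_finsetSum]
  exact hv

variable (k σ) in
/-- The functor `S ↦ X_S`. -/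
noncomputable def toricFunctor : AffSemimodᵒᵖ ⥤ ToricVar k σ where
  obj M := M.unop.toricVar k σ
  map φ := (AffSemimod.presentation k σ _).map (AffSemimod.presentation k σ _) φ.unop
  map_id _ := ToricVar.Presentation.map_id _
  map_comp _ _ := ToricVar.Presentation.map_comp _ _ _ _ _

instance : (toricFunctor k σ).Faithful where
  map_injective h := Quiver.Hom.unop_inj (ToricVar.Presentation.map_injective _ _ h)

instance : (toricFunctor k σ).Full where
  map_surjective f := by
    obtain ⟨φ, h⟩ := ToricVar.Presentation.map_surjective (AffSemimod.presentation k σ _)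
      (AffSemimod.presentation k σ _) f
    exact ⟨φ.op, h⟩

instance : (toricFunctor k σ).EssSurj where
  mem_essImage V := by
    obtain ⟨M, ⟨P⟩⟩ := V.exists_presentation
    exact ⟨op M, ⟨(AffSemimod.presentation k σ M).isoOfPresentations P⟩⟩

instance : (toricFunctor k σ).IsEquivalence where

variable (k σ) in
/-- The functor of points of `X_S` is `Spec k[S]`, naturally in `S`. -/
noncomputable def toricFunctorCompPoints :
    toricFunctor k σ ⋙ ToricVar.pointsFunctor k σ ≅ specFunctor k σ :=
  NatIso.ofComponents (fun M => (AffSemimod.presentation k σ M.unop).iso) fun φ =>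
    ToricVar.Presentation.mapPoints_comp_iso_hom _ _ φ.unop

end PDiff

theorem mainTheorem1 (k : Type u) [Field k] [CharZero k] (σ : k →+* k) :
    ∃ E : PDiff.AffSemimodᵒᵖ ≌ PDiff.ToricVar k σ,
      Nonempty (E.functor ⋙ PDiff.ToricVar.pointsFunctor k σ ≅ PDiff.specFunctor k σ) :=
  ⟨(PDiff.toricFunctor k σ).asEquivalence, ⟨PDiff.toricFunctorCompPoints k σ⟩⟩
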